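/- Let $q$ be a prime power. All matroids are finite. For a matroid $M$ on $E$ with rank function $r$, let $L(M)$ be its lattice of flats, $\mu$ the one-variable Möbius function of $L(M)$, and $\chi(M,t)=\sum_{F\in L(M)}\mu(F)\,t^{r(E)-r(F)}\in\mathbb{Z}[t]$ its characteristic polynomial. A flat $X$ of $M$ is modular if $r(X)+r(Y)=r(X\wedge Y)+r(X\vee Y)$ for every flat $Y$, where $X\wedge Y=X\cap Y$ and $X\vee Y$ is the smallest flat containing $X\cup Y$. A simple matroid $M$ of rank $n$ on $E$ is supersolvable if there are modular flats $\varnothing=X_0\subseteq X_1\subseteq\dots\subseteq X_n=E$ with $r(X_i)=i$ for all $i$. A simple matroid $M$ on $E$ is a modular join of $M|E_1$ and $M|E_2$ over $X=E_1\cap E_2$ if $E_1,E_2$ are proper modular flats of $M$ with $E=E_1\cup E_2$. An arrangement over $\mathbb{F}_q$ is a finite set $\mathcal{A}$ of linear hyperplanes in a finite-dimensional $\mathbb{F}_q$-vector space; its linear dependence matroid $M(\mathcal{A})$ is the matroid on $\mathcal{A}$ in which $\{H_1,\dots,H_m\}$ (with the $H_i$ distinct) is independent if and only if $H_1\cap\dots\cap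 H_m$ has codimension $m$. For $k\ge 0$, the projective geometry $\mathrm{PG}(k-1,q)$ is the linear dependence matroid of the arrangement of all linear hyperplanes in $\mathbb{F}_q^k$ (the empty matroid if $k=0$). The arrangement $\mathcal{A}$ is divisionally free if $M=M(\mathcal{A})$ has a divisional flag, that is, if, with $n$ the rank and $E=\mathcal{A}$ the ground set of $M$, there are flats $\varnothing=X_0\subseteq X_1\subseteq\dots\subseteq X_n=E$ of $M$ such that $r(X_i)=i$ for $0\le i\le n$ and $\chi(M/X_{i+1},t)$ divides $\chi(M/X_i,t)$ in $\mathbb{Z}[t]$ for $0\le i<n$. Let $\mathcal{F}_q$ be the smallest class of simple matroids representable over $\mathbb{F}_q$ such that (i) every supersolvable matroid representable over $\mathbb{F}_q$ belongs to $\mathcal{F}_q$; (ii) $\mathcal{F}_q$ is closed under modular joins over projective geometries: if a simple matroid $M$ representable over $\mathbb{F}_q$ is a modular join of $M_1,M_2\in\mathcal{F}_q$ over a flat $X$ such that $M|X$ is isomorphic to $\mathrm{PG}(k-1,q)$ for some $k\ge 0$, then $M\in\mathcal{F}_q$. If $\mathcal{A}$ is an arrangement over $\mathbb{F}_q$ and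 $M(\mathcal{A})\in\mathcal{F}_q$, then $\mathcal{A}$ is divisionally free. -/

import Mathlib

namespace Matroid

variable {α β : Type*}

/-- A matroid is simple if it has no loops and no parallel pairs, i.e. every subset of the ground
set with at most two elements is independent. -/
def IsSimple (M : Matroid α) : Prop :=
  ∀ e ∈ M.E, ∀ f ∈ M.E, M.Indep {e, f}

/-- `M` is representable over the field `K`: it is the matroid of linear dependence of a family of
vectors in some `K ^ n` indexed by the ground set. -/
def IsRepresentableOver (K : Type*) [Field K] (M : Matroid α) : Prop :=
  ∃ (n : ℕ) (v : α → Fin n → K), ∀ I ⊆ M.E, (M.Indep I ↔ LinearIndepOn K v I)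

/-- Isomorphism of matroids: a bijection of the ground sets that preserves and reflects
independence. -/
def IsIsomorphicTo (M : Matroid α) (N : Matroid β) : Prop :=
  ∃ e : M.E ≃ N.E, ∀ I : Set M.E,
    M.Indep (Subtype.val '' I) ↔ N.Indep (Subtype.val '' (e '' I))

/-- A flat `X` is modular if `r(X) + r(Y) = r(X ∧ Y) + r(X ∨ Y)` for all flats `Y`; in the lattice
of flats the meet is the intersection and the join is the closure of the union. -/
def IsModularFlat (M : Matroid α) (X : Set α) : Prop :=
  M.IsFlat X ∧ ∀ Y, M.IsFlat Y →
    M.eRk X + M.eRk Y = M.eRk (X ∩ Y) + M.eRk (M.closure (X ∪ Y))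

/-- A saturated chain of flats `∅ = X 0 ⊆ X 1 ⊆ ⋯ ⊆ X n = E` with `r (X i) = i`
(in particular `n` is the rank of `M`). -/
structure IsFullFlag (M : Matroid α) (n : ℕ) (X : Fin (n + 1) → Set α) : Prop where
  isFlat : ∀ i, M.IsFlat (X i)
  first : X 0 = ∅
  last : X (Fin.last n) = M.E
  mono : Monotone X
  rank : ∀ i, M.eRk (X i) = (i : ℕ)

/-- A simple matroid is supersolvable if it has a saturated chain consisting of modular flats. -/
def IsSupersolvable (M : Matroid α) : Prop :=
  M.IsSimple ∧ ∃ (n : ℕ) (X : Fin (n + 1) → Set α),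
    M.IsFullFlag n X ∧ ∀ i, M.IsModularFlat (X i)

/-- The simple matroid `M` is the modular join of `M ↾ E₁` and `M ↾ E₂` (over `E₁ ∩ E₂`): `E₁` and
`E₂` are proper modular flats whose union is the ground set. -/
structure IsModularJoin (M : Matroid α) (E₁ E₂ : Set α) : Prop where
  isSimple : M.IsSimple
  modular_left : M.IsModularFlat E₁
  modular_right : M.IsModularFlat E₂
  proper_left : E₁ ≠ M.E
  proper_right : E₂ ≠ M.E
  union_eq : E₁ ∪ E₂ = M.E

/-- The lattice of flats, ordered by inclusion. -/
abbrev FlatLattice (M : Matroid α) : Type _ := {F : Set α // M.IsFlat F}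

instance finite_flatLattice (M : Matroid α) [M.Finite] : Finite M.FlatLattice :=
  (M.ground_finite.finite_subsets.subset fun _ hF ↦ IsFlat.subset_ground hF).to_subtype

noncomputable instance fintype_flatLattice (M : Matroid α) [M.Finite] : Fintype M.FlatLattice :=
  Fintype.ofFinite _

open Classical in
noncomputable instance locallyFiniteOrder_flatLattice (M : Matroid α) [M.Finite] :
    LocallyFiniteOrder M.FlatLattice :=
  Fintype.toLocallyFiniteOrder

/-- The least flat, i.e. the closure of the empty set. -/
def leastFlat (M : Matroid α) : M.FlatLattice := ⟨M.closure ∅, M.isFlat_closure ∅⟩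

open Classical in
/-- The one-variable Möbius function `μ(F) = μ(0, F)` of the lattice of flats. -/
noncomputable def flatMobius (M : Matroid α) [M.Finite] (F : M.FlatLattice) : ℤ :=
  IncidenceAlgebra.mu ℤ M.leastFlat F

/-- The characteristic polynomial `χ(M, t) = ∑ μ(F) t ^ (r(M) - r(F))`, summed over the flats. -/
noncomputable def charPoly (M : Matroid α) [M.Finite] : Polynomial ℤ :=
  ∑ F : M.FlatLattice,
    Polynomial.C (M.flatMobius F) * Polynomial.X ^ (M.eRank - M.eRk F.1).toNat

/-- `M` has a divisional flag: a saturated chain of flats `∅ = X 0 ⊆ ⋯ ⊆ X n = E` such that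
`χ(M / X (i + 1), t)` divides `χ(M / X i, t)` for all `i < n`. -/
def HasDivisionalFlag (M : Matroid α) [M.Finite] : Prop :=
  ∃ (n : ℕ) (X : Fin (n + 1) → Set α), M.IsFullFlag n X ∧
    ∀ i : Fin n, (M ／ X i.succ).charPoly ∣ (M ／ X i.castSucc).charPoly

end Matroid

/-- A (central) hyperplane arrangement: a finite set of subspaces of codimension one. -/
structure HyperplaneArrangement (K V : Type*) [Field K] [AddCommGroup V] [Module K V] where
  hyperplanes : Set (Submodule K V)
  finite : hyperplanes.Finite
  codim_eq_one : ∀ H ∈ hyperplanes, Module.finrank K (V ⧸ H) = 1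

namespace HyperplaneArrangement

variable {K V : Type*} [Field K] [AddCommGroup V] [Module K V]

theorem codim_inf_le [FiniteDimensional K V] (W H : Submodule K V)
    (hH : Module.finrank K (V ⧸ H) = 1) :
    Module.finrank K (V ⧸ (H ⊓ W)) ≤ Module.finrank K (V ⧸ W) + 1 := by
  have h1 := Submodule.finrank_quotient_add_finrank H
  have h2 := Submodule.finrank_quotient_add_finrank W
  have h3 := Submodule.finrank_quotient_add_finrank (H ⊓ W)
  have h4 := Submodule.finrank_sup_add_finrank_inf_eq H W
  have h5 := Submodule.finrank_le (H ⊔ W)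
  omega

/-- If adding `H` does not raise the codimension of the intersection `W`, then `W ≤ H`. -/
theorem le_of_codim_inf_eq [FiniteDimensional K V] (W H : Submodule K V)
    (h : Module.finrank K (V ⧸ (H ⊓ W)) ≤ Module.finrank K (V ⧸ W)) : W ≤ H := by
  have h2 := Submodule.finrank_quotient_add_finrank W
  have h3 := Submodule.finrank_quotient_add_finrank (H ⊓ W)
  have h4 : H ⊓ W = W := Submodule.eq_of_le_of_finrank_le inf_le_right (by omega)
  exact inf_eq_right.mp h4

theorem codim_anti [FiniteDimensional K V] {U W : Submodule K V} (h : U ≤ W) :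
    Module.finrank K (V ⧸ W) ≤ Module.finrank K (V ⧸ U) := by
  have h2 := Submodule.finrank_quotient_add_finrank W
  have h3 := Submodule.finrank_quotient_add_finrank U
  have h4 := Submodule.finrank_mono h
  omega

theorem codim_union_le [FiniteDimensional K V] (I : Set (Submodule K V))
    {J : Set (Submodule K V)} (hJ : J.Finite) (h1 : ∀ H ∈ J, Module.finrank K (V ⧸ H) = 1) :
    Module.finrank K (V ⧸ sInf (J ∪ I)) ≤ Module.finrank K (V ⧸ sInf I) + J.ncard := by
  induction J, hJ using Set.Finite.induction_on with
  | empty => rw [Set.empty_union, Set.ncard_empty, add_zero]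
  | @insert H J hHJ hJ ih =>
    rw [Set.insert_union, sInf_insert, Set.ncard_insert_of_notMem hHJ hJ]
    have := codim_inf_le (sInf (J ∪ I)) H (h1 H (Set.mem_insert _ _))
    have := ih fun H' h' ↦ h1 H' (Set.mem_insert_of_mem _ h')
    omega

/-- Independence of a set of hyperplanes: the codimension of their intersection is their number. -/
def Indep (A : HyperplaneArrangement K V) (B : Set (Submodule K V)) : Prop :=
  B ⊆ A.hyperplanes ∧ Module.finrank K (V ⧸ sInf B) = B.ncard

/-- The linear dependence matroid `M(A)` on the set of hyperplanes of `A`. -/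
def matroid [FiniteDimensional K V] (A : HyperplaneArrangement K V) : Matroid (Submodule K V) :=
  (IndepMatroid.ofFinite A.finite A.Indep
    (by
      refine ⟨Set.empty_subset _, ?_⟩
      have := Submodule.finrank_quotient_add_finrank (⊤ : Submodule K V)
      rw [finrank_top] at this
      rw [sInf_empty, Set.ncard_empty]
      omega)
    (by
      rintro I J ⟨hJA, hJ⟩ hIJ
      have hJf := A.finite.subset hJA
      have hIf := hJf.subset hIJ
      refine ⟨hIJ.trans hJA, ?_⟩
      have a := codim_union_le I (J := J \ I) (hJf.subset Set.sdiff_subset)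
        fun H hH ↦ A.codim_eq_one H (hJA hH.1)
      have b := codim_union_le ∅ hIf fun H hH ↦ A.codim_eq_one H (hJA (hIJ hH))
      have c := Submodule.finrank_quotient_add_finrank (⊤ : Submodule K V)
      have d := Set.ncard_sdiff_add_ncard_of_subset hIJ hJf
      rw [finrank_top] at c
      rw [Set.sdiff_union_of_subset hIJ] at a
      rw [Set.union_empty, sInf_empty] at b
      omega)
    (by
      rintro I J ⟨hIA, hI⟩ ⟨hJA, hJ⟩ hlt
      by_contra! hcon
      have key : sInf I ≤ sInf J := by
        refine le_sInf fun H hH ↦ ?_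
        by_cases hHI : H ∈ I
        · exact sInf_le hHI
        · have h1 : ¬ Module.finrank K (V ⧸ sInf (insert H I)) = (insert H I).ncard :=
            fun h ↦ hcon H hH hHI ⟨Set.insert_subset (hJA hH) hIA, h⟩
          rw [sInf_insert, Set.ncard_insert_of_notMem hHI (A.finite.subset hIA)] at h1
          have h2 := codim_inf_le (sInf I) H (A.codim_eq_one H (hJA hH))
          exact le_of_codim_inf_eq _ _ (by omega)
      have := codim_anti key
      omega)
    (fun _ h ↦ h.1)).matroid

instance finite_matroid [FiniteDimensional K V] (A : HyperplaneArrangement K V) :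
    A.matroid.Finite := ⟨A.finite⟩

/-- An arrangement is divisionally free if its linear dependence matroid has a divisional flag. -/
def IsDivisionallyFree [FiniteDimensional K V] (A : HyperplaneArrangement K V) : Prop :=
  A.matroid.HasDivisionalFlag

/-- The arrangement of all hyperplanes of the vector space `K ^ k` over a finite field. -/
def allHyperplanes (K : Type*) [Field K] [Finite K] (k : ℕ) :
    HyperplaneArrangement K (Fin k → K) where
  hyperplanes := {H | Module.finrank K ((Fin k → K) ⧸ H) = 1}
  finite :=
    haveI : Finite (Submodule K (Fin k → K)) := Finite.of_injective _ SetLike.coe_injective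
    Set.toFinite _
  codim_eq_one := fun _ h ↦ h

end HyperplaneArrangement

/-- The projective geometry `PG(k - 1, q)` of rank `k`, where `q` is the order of `K`: the linear
dependence matroid of the arrangement of all hyperplanes of `K ^ k`. It is empty for `k = 0`. -/
def projectiveGeometry (K : Type*) [Field K] [Finite K] (k : ℕ) :
    Matroid (Submodule K (Fin k → K)) :=
  (HyperplaneArrangement.allHyperplanes K k).matroid

/-- The smallest class of finite simple matroids representable over the finite field `K` that
contains the supersolvable ones and is closed under modular joins over projective geometries
over `K`. The factors of a modular join are restrictions of it, so the class is generated
separately on each type of potential elements. -/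
inductive MemJoinClass (K : Type*) [Field K] [Finite K] {α : Type*} : Matroid α → Prop
  | supersolvable (M : Matroid α) (hfin : M.Finite) (hrep : M.IsRepresentableOver K)
      (hss : M.IsSupersolvable) : MemJoinClass K M
  | modularJoin (M : Matroid α) (hfin : M.Finite) (hrep : M.IsRepresentableOver K)
      (E₁ E₂ : Set α) (hjoin : M.IsModularJoin E₁ E₂)
      (k : ℕ) (hPG : (M.restrict (E₁ ∩ E₂)).IsIsomorphicTo (projectiveGeometry K k))
      (h₁ : MemJoinClass K (M.restrict E₁)) (h₂ : MemJoinClass K (M.restrict E₂)) : MemJoinClass K M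

/-! A divisional flag of a modular join cannot be assembled from flags of its factors alone, so the
induction proves more. Call a flat full if it contains every projective point of its span in a fixed
representation. For each member of the class and each full flat `X`, there is a divisional chain
from the bottom to a complement of `X`. For `X = ∅` the complement is the whole ground set, and the
chain is a flag.

Two facts about a modular `x` in `[⊥, w]` drive the proof. If `y` meets `x` trivially, joining with
`y` gives `[⊥, x] ≅ [y, x ⊔ y]`, which lifts chains. Also (Stanley) the polynomial of `[a, x]`
divides that of `[a, w]` for `a ≤ x`.

Modular join (`HasDivisionalComplement.join`): let `w` be covered by modular `x` and `x'`. Follow a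
chain below `x` to a complement `y` of `x ⊓ x'`. Its members meet `x'` trivially, so Stanley's
cofactor stays constant along it, and divisibility passes from `[b, x]` to `[b, w]`. Since `[⊥, x']
≅ [y, w]`, a chain below `x'` then continues the first one. The meet is full because it is a
projective geometry. A full `X` lies in one factor, since a vector space is not the union of two
proper subspaces.

Supersolvable case (`HasDivisionalComplement.of_supersolvable`): induct along the modular chain,
with coatom `t`. If an atom `e` avoids both `t` and `X`, step to `e` and lift a chain in `t` that
complements the projection of `X` from `e`. Otherwise `t` and `X` cover everything, and the join
argument applies. -/

/-! ### Möbius functions and characteristic polynomials of intervals -/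

namespace IncidenceAlgebra

open Finset

variable {L L' : Type*} [PartialOrder L] [LocallyFiniteOrder L] [DecidableEq L]
  [PartialOrder L'] [LocallyFiniteOrder L'] [DecidableEq L']

/-- The Möbius function is determined by its partial sums over the intervals `[a, c]`. -/
theorem eq_mu_of_sum_Icc {f : L → ℤ} {a b : L} (hab : a ≤ b)
    (h : ∀ c ∈ Icc a b, ∑ x ∈ Icc a c, f x = if a = c then 1 else 0) : f b = mu ℤ a b := by
  induction hn : #(Icc a b) using Nat.strong_induction_on generalizing b with
  | _ n ih =>
    have h1 := h b (right_mem_Icc.2 hab)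
    rw [← sum_Icc_mu_right, Icc_eq_cons_Ico hab, sum_cons, sum_cons] at h1
    have h2 : ∑ x ∈ Ico a b, f x = ∑ x ∈ Ico a b, mu ℤ a x := by
      refine sum_congr rfl fun x hx ↦ ?_
      rw [mem_Ico] at hx
      refine ih _ ?_ hx.1 (fun c hc ↦ h c (Icc_subset_Icc_right hx.2.le hc)) rfl
      rw [← hn]
      exact card_lt_card (Icc_ssubset_Icc_right hab le_rfl hx.2)
    linarith

/-- The Möbius function is preserved by maps that are bijective on all intervals `[a, c]`,
`c ≤ b`. -/
theorem mu_eq_mu_of_bijOn {g : L → L'} {a b : L} (hab : a ≤ b)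
    (hg : ∀ c ∈ Set.Icc a b, Set.BijOn g (Set.Icc a c) (Set.Icc (g a) (g c))) :
    mu ℤ a b = mu ℤ (g a) (g b) := by
  refine (eq_mu_of_sum_Icc (f := fun c ↦ mu ℤ (g a) (g c)) hab fun c hc ↦ ?_).symm
  rw [mem_Icc] at hc
  have hb := hg c hc
  have hinj : a = c ↔ g a = g c :=
    ⟨fun h ↦ h ▸ rfl, fun h ↦ hb.injOn ⟨le_rfl, hc.1⟩ ⟨hc.1, le_rfl⟩ h⟩
  rw [sum_nbij g (t := Icc (g a) (g c)) (g := fun y ↦ mu ℤ (g a) y), sum_Icc_mu_right]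
  · simp only [hinj]
  · intro x hx
    rw [mem_Icc] at hx ⊢
    exact hb.mapsTo hx
  · rw [coe_Icc]; exact hb.injOn
  · rw [coe_Icc, coe_Icc]; exact hb.surjOn
  · simp

end IncidenceAlgebra

open IncidenceAlgebra Polynomial in
/-- The characteristic polynomial of the interval `[a, b]` with respect to the rank
function `ρ`. -/
noncomputable def intervalCharPoly {L : Type*} [PartialOrder L] [LocallyFiniteOrder L]
    [DecidableEq L] (ρ : L → ℕ) (a b : L) : ℤ[X] :=
  ∑ z ∈ Finset.Icc a b, C (mu ℤ a z) * X ^ (ρ b - ρ z)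

theorem intervalCharPoly_eq_of_bijOn {L L' : Type*} [PartialOrder L] [LocallyFiniteOrder L]
    [DecidableEq L] [PartialOrder L'] [LocallyFiniteOrder L'] [DecidableEq L']
    {ρ : L → ℕ} {ρ' : L' → ℕ} {g : L → L'} {a b : L}
    (hab : a ≤ b) (hg : ∀ c ∈ Set.Icc a b, Set.BijOn g (Set.Icc a c) (Set.Icc (g a) (g c)))
    (hρ : ∀ c ∈ Set.Icc a b, ρ b - ρ c = ρ' (g b) - ρ' (g c)) :
    intervalCharPoly ρ a b = intervalCharPoly ρ' (g a) (g b) := by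
  have hb := hg b ⟨hab, le_rfl⟩
  refine Finset.sum_nbij g ?_ ?_ ?_ ?_
  · intro x hx
    rw [Finset.mem_Icc] at hx ⊢
    exact hb.mapsTo hx
  · rw [Finset.coe_Icc]; exact hb.injOn
  · rw [Finset.coe_Icc, Finset.coe_Icc]; exact hb.surjOn
  · intro c hc
    rw [Finset.mem_Icc] at hc
    rw [hρ c hc, IncidenceAlgebra.mu_eq_mu_of_bijOn hc.1 fun d hd ↦ hg d ⟨hd.1, hd.2.trans hc.2⟩]

/-! ### Modular elements of semimodular lattices -/

/-- A strictly monotone submodular function that vanishes at the bottom. -/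
structure IsSemimodularRank {L : Type*} [Lattice L] [OrderBot L] (ρ : L → ℕ) : Prop where
  strictMono : StrictMono ρ
  bot : ρ ⊥ = 0
  submodular : ∀ x y, ρ (x ⊓ y) + ρ (x ⊔ y) ≤ ρ x + ρ y

/-- `x` is a modular element of the interval `[⊥, w]`. -/
structure IsModularBelow {L : Type*} [Lattice L] (ρ : L → ℕ) (w x : L) : Prop where
  le : x ≤ w
  modular : ∀ y ≤ w, ρ x + ρ y = ρ (x ⊓ y) + ρ (x ⊔ y)

namespace IsModularBelow

variable {L : Type*} [Lattice L] {ρ : L → ℕ} {w x y u a : L}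

theorem mono (h : IsModularBelow ρ w x) {w' : L} (hx : x ≤ w') (hw : w' ≤ w) :
    IsModularBelow ρ w' x :=
  ⟨hx, fun y hy ↦ h.modular y (hy.trans hw)⟩

variable [OrderBot L]

/-- Submodularity gives one inequality. For the other, apply modularity of `x` to `u ⊔ y`: its join
with `x` is `x ⊔ y`, and its meet with `x` has rank at least `ρ u`. -/
theorem rank_sup_add (hρ : IsSemimodularRank ρ) (h : IsModularBelow ρ w x) (hy : y ≤ w)
    (hyx : y ⊓ x = a) (hau : a ≤ u)
    (hux : u ≤ x) : ρ (u ⊔ y) + ρ a = ρ u + ρ y := by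
  have h1 := h.modular y hy
  have h2 := h.modular (u ⊔ y) (sup_le (hux.trans h.le) hy)
  have h3 := hρ.submodular u y
  have h4 : u ⊓ y = a := by
    refine le_antisymm ?_ (le_inf hau (hyx ▸ inf_le_left))
    rw [← hyx]; exact le_inf inf_le_right (inf_le_left.trans hux)
  have h5 := hρ.strictMono.monotone (le_inf hux (le_sup_left : u ≤ u ⊔ y))
  have h6 : x ⊔ (u ⊔ y) = x ⊔ y := by rw [← sup_assoc, sup_eq_left.2 hux]
  rw [inf_comm, hyx] at h1
  rw [h6] at h2
  rw [h4] at h3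
  omega

theorem rank_sup (hρ : IsSemimodularRank ρ) (h : IsModularBelow ρ w x) (hy : y ≤ w)
    (hyx : y ⊓ x = ⊥) (hux : u ≤ x) :
    ρ (u ⊔ y) = ρ u + ρ y := by
  have := h.rank_sup_add hρ hy hyx bot_le hux
  rw [hρ.bot] at this
  exact this

/-- A strictly larger meet would violate the rank count. With `inf_sup_eq`, this makes joining with
`y` and meeting with `x` mutually inverse. -/
theorem sup_inf_eq (hρ : IsSemimodularRank ρ) (h : IsModularBelow ρ w x) (hy : y ≤ w)
    (hyx : y ⊓ x = ⊥) (hux : u ≤ x) :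
    (u ⊔ y) ⊓ x = u := by
  by_contra hne
  have h0 : u < (u ⊔ y) ⊓ x := lt_of_le_of_ne (le_inf le_sup_left hux) (Ne.symm hne)
  have h1 := h.rank_sup hρ hy hyx hux
  have h2 := h.rank_sup hρ hy hyx le_rfl
  have h3 := h.modular (u ⊔ y) (sup_le (hux.trans h.le) hy)
  have h4 := hρ.strictMono h0
  have h6 : x ⊔ (u ⊔ y) = x ⊔ y := by rw [← sup_assoc, sup_eq_left.2 hux]
  rw [h6, inf_comm] at h3
  omega

theorem inf_sup_eq (hρ : IsSemimodularRank ρ) (h : IsModularBelow ρ w x) (hy : y ≤ w)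
    (hyx : y ⊓ x = ⊥) {z : L}
    (hyz : y ≤ z) (hz : z ≤ x ⊔ y) : (z ⊓ x) ⊔ y = z := by
  by_contra hne
  have h0 : (z ⊓ x) ⊔ y < z := lt_of_le_of_ne (sup_le inf_le_left hyz) hne
  have h1 := h.rank_sup hρ hy hyx (inf_le_right : z ⊓ x ≤ x)
  have h2 := h.rank_sup hρ hy hyx le_rfl
  have h3 := h.modular z (hz.trans (sup_le h.le hy))
  have h4 := hρ.strictMono h0
  have h6 : x ⊔ z = x ⊔ y := le_antisymm (sup_le le_sup_left hz) (sup_le_sup_left hyz _)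
  rw [h6, inf_comm] at h3
  omega

/-- Joining with `y` maps `[a, b]` bijectively to `[a ⊔ y, b ⊔ y]` if `b` lies below a modular
element that meets `y` trivially. -/
theorem bijOn_sup (hρ : IsSemimodularRank ρ) (h : IsModularBelow ρ w x) (hy : y ≤ w)
    (hyx : y ⊓ x = ⊥) {b : L}
    (hab : a ≤ b) (hbx : b ≤ x) :
    Set.BijOn (· ⊔ y) (Set.Icc a b) (Set.Icc (a ⊔ y) (b ⊔ y)) := by
  refine ⟨fun z hz ↦ ⟨sup_le_sup_right hz.1 _, sup_le_sup_right hz.2 _⟩, ?_, ?_⟩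
  · intro z hz z' hz' heq
    have h1 := h.sup_inf_eq hρ hy hyx (hz.2.trans hbx)
    have h2 := h.sup_inf_eq hρ hy hyx (hz'.2.trans hbx)
    simp only at heq
    rw [← h1, ← h2, heq]
  · intro z hz
    refine ⟨z ⊓ x, ⟨?_, ?_⟩, ?_⟩
    · exact le_inf (le_sup_left.trans hz.1) (hab.trans hbx)
    · calc z ⊓ x ≤ (b ⊔ y) ⊓ x := inf_le_inf_right _ hz.2
        _ = b := h.sup_inf_eq hρ hy hyx hbx
    · exact h.inf_sup_eq hρ hy hyx (le_sup_right.trans hz.1)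
        (hz.2.trans (sup_le_sup_right hbx _))

variable [LocallyFiniteOrder L] [DecidableEq L]

theorem mu_sup (hρ : IsSemimodularRank ρ) (h : IsModularBelow ρ w x) (hy : y ≤ w)
    (hyx : y ⊓ x = ⊥) {b : L}
    (hab : a ≤ b) (hbx : b ≤ x) :
    IncidenceAlgebra.mu ℤ a b = IncidenceAlgebra.mu ℤ (a ⊔ y) (b ⊔ y) :=
  IncidenceAlgebra.mu_eq_mu_of_bijOn (g := (· ⊔ y)) hab fun _ hc ↦
    h.bijOn_sup hρ hy hyx hc.1 (hc.2.trans hbx)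

theorem intervalCharPoly_sup (hρ : IsSemimodularRank ρ) (h : IsModularBelow ρ w x) (hy : y ≤ w)
    (hyx : y ⊓ x = ⊥) {b : L}
    (hab : a ≤ b) (hbx : b ≤ x) :
    intervalCharPoly ρ a b = intervalCharPoly ρ (a ⊔ y) (b ⊔ y) := by
  refine intervalCharPoly_eq_of_bijOn (g := (· ⊔ y)) hab
    (fun _ hc ↦ h.bijOn_sup hρ hy hyx hc.1 (hc.2.trans hbx)) fun c hc ↦ ?_
  have h1 := h.rank_sup hρ hy hyx hbx
  have h2 := h.rank_sup hρ hy hyx (hc.2.trans hbx)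
  omega

end IsModularBelow

/-! ### The modular factorization of the characteristic polynomial -/

section Factorization

open IncidenceAlgebra Polynomial Finset

variable {L : Type*} [Lattice L] [LocallyFiniteOrder L] [DecidableEq L]

/-- Every element `x` of a lattice splits the Möbius function into a part below `x` and a part
that meets `x` trivially. -/
theorem mu_eq_sum_mul {a x w z : L} (hax : a ≤ x) (haz : a ≤ z) (hzw : z ≤ w) :
    mu ℤ a z = ∑ p ∈ Icc a x ×ˢ {y ∈ Icc a w | y ⊓ x = a} with p.1 ⊔ p.2 = z,
      mu ℤ a p.1 * mu ℤ a p.2 := by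
  symm
  refine eq_mu_of_sum_Icc (f := fun z ↦ ∑ p ∈ Icc a x ×ˢ {y ∈ Icc a w | y ⊓ x = a} with
    p.1 ⊔ p.2 = z, mu ℤ a p.1 * mu ℤ a p.2) haz fun c hc ↦ ?_
  rw [mem_Icc] at hc
  have hcw := hc.2.trans hzw
  -- Since `u ⊔ y ≤ c` separates into conditions on `u` and on `y`, the sum factors. The first
  -- factor vanishes unless `x ⊓ c = a`, and then the condition `y ⊓ x = a` is automatic for `y` in
  -- `[a, c]`.
  have h1 : ∑ z ∈ Icc a c, ∑ p ∈ Icc a x ×ˢ {y ∈ Icc a w | y ⊓ x = a} with p.1 ⊔ p.2 = z,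
      mu ℤ a p.1 * mu ℤ a p.2 =
      ∑ p ∈ Icc a (x ⊓ c) ×ˢ {y ∈ Icc a c | y ⊓ x = a}, mu ℤ a p.1 * mu ℤ a p.2 := by
    rw [← sum_fiberwise_of_maps_to (s := Icc a (x ⊓ c) ×ˢ {y ∈ Icc a c | y ⊓ x = a})
      (t := Icc a c) (g := fun p ↦ p.1 ⊔ p.2)]
    · refine sum_congr rfl fun z hz ↦ sum_congr ?_ fun _ _ ↦ rfl
      rw [mem_Icc] at hz
      ext ⟨u, y⟩
      simp only [mem_filter, mem_product, mem_Icc, le_inf_iff]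
      constructor
      · rintro ⟨⟨⟨h1, h2⟩, ⟨h3, h4⟩, h5⟩, rfl⟩
        exact ⟨⟨⟨h1, h2, le_sup_left.trans hz.2⟩, ⟨h3, le_sup_right.trans hz.2⟩, h5⟩, rfl⟩
      · rintro ⟨⟨⟨h1, h2, -⟩, ⟨h3, h4⟩, h5⟩, rfl⟩
        exact ⟨⟨⟨h1, h2⟩, ⟨h3, h4.trans hcw⟩, h5⟩, rfl⟩
    · rintro ⟨u, y⟩ hp
      simp only [mem_filter, mem_product, mem_Icc, le_inf_iff] at hp ⊢
      exact ⟨hp.1.1.trans le_sup_left, sup_le hp.1.2.2 hp.2.1.2⟩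
  rw [h1, sum_product, ← sum_mul_sum, sum_Icc_mu_right]
  by_cases hxc : a = x ⊓ c
  · rw [if_pos hxc, one_mul, ← sum_Icc_mu_right]
    refine sum_congr (filter_true_of_mem fun y hy ↦ ?_) fun _ _ ↦ rfl
    rw [mem_Icc] at hy
    refine le_antisymm ?_ (le_inf hy.1 hax)
    rw [hxc]
    exact le_inf inf_le_right (inf_le_left.trans hy.2)
  · rw [if_neg hxc, zero_mul, if_neg]
    rintro rfl
    exact hxc (inf_eq_right.2 hax).symm

/-- The cofactor of the characteristic polynomial of `[a, x]` in that of `[a, w]`. -/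
noncomputable def modularCofactor (ρ : L → ℕ) (a x w : L) : ℤ[X] :=
  ∑ y ∈ Icc a w with y ⊓ x = a, C (mu ℤ a y) * X ^ (ρ w - ρ x - (ρ y - ρ a))

variable [OrderBot L] {ρ : L → ℕ}

/-- The Möbius values split for any `x`; modularity makes the rank of `u ⊔ y` additive, so the
powers of the variable split too. -/
theorem IsModularBelow.intervalCharPoly_eq_mul (hρ : IsSemimodularRank ρ) {a x w : L}
    (h : IsModularBelow ρ w x) (hax : a ≤ x) :
    intervalCharPoly ρ a w = intervalCharPoly ρ a x * modularCofactor ρ a x w := by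
  have h1 : intervalCharPoly ρ a w =
      ∑ p ∈ Icc a x ×ˢ {y ∈ Icc a w | y ⊓ x = a},
        C (mu ℤ a p.1 * mu ℤ a p.2) * X ^ (ρ w - ρ (p.1 ⊔ p.2)) := by
    rw [← sum_fiberwise_of_maps_to (s := Icc a x ×ˢ {y ∈ Icc a w | y ⊓ x = a})
      (t := Icc a w) (g := fun p ↦ p.1 ⊔ p.2), intervalCharPoly]
    · refine sum_congr rfl fun z hz ↦ ?_
      rw [mem_Icc] at hz
      rw [mu_eq_sum_mul hax hz.1 hz.2, map_sum, sum_mul]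
      refine sum_congr rfl fun p hp ↦ ?_
      rw [(mem_filter.1 hp).2]
    · rintro ⟨u, y⟩ hp
      simp only [mem_filter, mem_product, mem_Icc] at hp ⊢
      exact ⟨hp.1.1.trans le_sup_left, sup_le (hp.1.2.trans h.le) hp.2.1.2⟩
  rw [h1, intervalCharPoly, modularCofactor, sum_mul_sum, sum_product]
  refine sum_congr rfl fun u hu ↦ sum_congr rfl fun y hy ↦ ?_
  rw [mem_Icc] at hu
  rw [mem_filter, mem_Icc] at hy
  have h2 := h.rank_sup_add hρ hy.1.2 hy.2 hu.1 hu.2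
  have h3 := h.rank_sup_add hρ hy.1.2 hy.2 hax le_rfl
  have h4 := hρ.strictMono.monotone (sup_le h.le hy.1.2)
  have h5 := hρ.strictMono.monotone hy.1.1
  have h6 := hρ.strictMono.monotone hu.2
  have h7 : ρ w - ρ (u ⊔ y) = (ρ x - ρ u) + (ρ w - ρ x - (ρ y - ρ a)) := by omega
  rw [h7, pow_add, map_mul]
  ring

/-- If every element of `[⊥, w]` is the join of its parts below `x` and `x'`, the cofactor of
`[y, x]` does not depend on `y`, as long as `y` meets `x'` trivially. -/
theorem modularCofactor_eq_sum (hρ : IsSemimodularRank ρ) {x x' w y : L}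
    (h : IsModularBelow ρ w x) (h' : IsModularBelow ρ w x')
    (hcover : ∀ z ≤ w, z ≤ (z ⊓ x) ⊔ (z ⊓ x')) (hyx : y ≤ x) (hyx' : y ⊓ x' = ⊥) :
    modularCofactor ρ y x w =
      ∑ z ∈ Icc ⊥ x' with z ⊓ x = ⊥, C (mu ℤ ⊥ z) * X ^ (ρ w - ρ x - ρ z) := by
  have hyw := hyx.trans h.le
  symm
  -- If `z ⊓ x = y`, the covering hypothesis says `z = y ⊔ (z ⊓ x')`, so the two maps are inverse.
  refine sum_nbij' (fun z ↦ z ⊔ y) (fun z ↦ z ⊓ x') ?_ ?_ ?_ ?_ ?_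
  · intro z hz
    simp only [mem_filter, mem_Icc] at hz ⊢
    refine ⟨⟨le_sup_right, sup_le (hz.1.2.trans h'.le) hyw⟩, ?_⟩
    rw [sup_comm]
    exact h.sup_inf_eq hρ (hz.1.2.trans h'.le) hz.2 hyx
  · intro z hz
    simp only [mem_filter, mem_Icc] at hz ⊢
    refine ⟨⟨bot_le, inf_le_right⟩, ?_⟩
    rw [inf_right_comm, hz.2, hyx']
  · intro z hz
    simp only [mem_filter, mem_Icc] at hz
    exact h'.sup_inf_eq hρ hyw hyx' hz.1.2
  · intro z hz
    simp only [mem_filter, mem_Icc] at hz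
    refine le_antisymm (sup_le inf_le_left hz.1.1) ?_
    have := hcover z hz.1.2
    rwa [hz.2, sup_comm] at this
  · intro z hz
    simp only [mem_filter, mem_Icc] at hz
    have h1 := h'.mu_sup hρ hyw hyx' bot_le hz.1.2
    have h2 := h'.rank_sup hρ hyw hyx' hz.1.2
    rw [bot_sup_eq] at h1
    rw [h1, h2, Nat.add_sub_cancel]

end Factorization

/-! ### Divisional chains -/

section DivisionalChain

open Relation

variable {L : Type*} [Lattice L] [OrderBot L] [LocallyFiniteOrder L] [DecidableEq L]

/-- A step of a divisional chain of the interval `[⊥, w]`. -/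
structure DivisionalStep (ρ : L → ℕ) (w a b : L) : Prop where
  le : a ≤ b
  le_top : b ≤ w
  rank : ρ b = ρ a + 1
  dvd : intervalCharPoly ρ b w ∣ intervalCharPoly ρ a w

/-- There is a divisional chain from `⊥` to a complement of `x` in the interval `[⊥, w]`. -/
def HasDivisionalComplement (ρ : L → ℕ) (w x : L) : Prop :=
  ∃ z ≤ w, ReflTransGen (DivisionalStep ρ w) ⊥ z ∧ z ⊓ x = ⊥ ∧ ρ z + ρ x = ρ w

variable {ρ : L → ℕ}

theorem HasDivisionalComplement.self (hρ : IsSemimodularRank ρ) (w : L) :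
    HasDivisionalComplement ρ w w :=
  ⟨⊥, bot_le, .refl, bot_inf_eq _, by rw [hρ.bot, zero_add]⟩

/-- Divisional chains below a modular element can be lifted along the join with `y`. -/
theorem IsModularBelow.lift_chain (hρ : IsSemimodularRank ρ) {w x y z : L}
    (h : IsModularBelow ρ w x) (hy : y ≤ w) (hyx : y ⊓ x = ⊥) (hw : x ⊔ y = w)
    (hz : ReflTransGen (DivisionalStep ρ x) ⊥ z) :
    ReflTransGen (DivisionalStep ρ w) y (z ⊔ y) := by
  have := hz.lift (r := DivisionalStep ρ x) (p := DivisionalStep ρ w) (fun z ↦ z ⊔ y) ?_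
  · rwa [Function.onFun, bot_sup_eq] at this
  · intro a b hab
    refine ⟨sup_le_sup_right hab.le _, sup_le (hab.le_top.trans h.le) hy, ?_, ?_⟩
    · rw [h.rank_sup hρ hy hyx hab.le_top, h.rank_sup hρ hy hyx (hab.le.trans hab.le_top), hab.rank]
      ring
    · have hd := hab.dvd
      rwa [h.intervalCharPoly_sup hρ hy hyx hab.le_top le_rfl,
        h.intervalCharPoly_sup hρ hy hyx (hab.le.trans hab.le_top) le_rfl, hw] at hd

/-- Divisional complements in modular joins. -/
theorem HasDivisionalComplement.join (hρ : IsSemimodularRank ρ) {w x x' p : L}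
    (h : IsModularBelow ρ w x) (h' : IsModularBelow ρ w x')
    (hcover : ∀ z ≤ w, z ≤ (z ⊓ x) ⊔ (z ⊓ x'))
    (hx : HasDivisionalComplement ρ x (x ⊓ x')) (hp : p ≤ x')
    (hx' : HasDivisionalComplement ρ x' p) : HasDivisionalComplement ρ w p := by
  obtain ⟨y, hyx, hchain, hy, hry⟩ := hx
  obtain ⟨z, hzx, hchain', hz, hrz⟩ := hx'
  rw [← inf_assoc, inf_eq_left.2 hyx] at hy
  have hyw := hyx.trans h.le
  have hsup : x ⊔ x' = w := by
    refine le_antisymm (sup_le h.le h'.le) ?_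
    have := hcover w le_rfl
    rwa [inf_eq_right.2 h.le, inf_eq_right.2 h'.le] at this
  have hmod := h.modular x' h'.le
  rw [hsup] at hmod
  have hrank := h'.rank_sup hρ hyw hy le_rfl
  have hw : x' ⊔ y = w := by
    by_contra hne
    have := hρ.strictMono (lt_of_le_of_ne (sup_le h'.le hyw) hne)
    omega
  -- Both ends of a step have the same cofactor in `[⊥, w]`, so the divisibility inside `x` is
  -- multiplied by it.
  have hfirst : ∀ y, ReflTransGen (DivisionalStep ρ x) ⊥ y → y ⊓ x' = ⊥ →
      ReflTransGen (DivisionalStep ρ w) ⊥ y := by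
    intro y hy
    induction hy with
    | refl => exact fun _ ↦ .refl
    | @tail b c hb hbc ih =>
      intro hc
      have hb' : b ⊓ x' = ⊥ := le_bot_iff.1 (hc ▸ inf_le_inf_right _ hbc.le)
      refine (ih hb').tail ⟨hbc.le, hbc.le_top.trans h.le, hbc.rank, ?_⟩
      rw [h.intervalCharPoly_eq_mul hρ hbc.le_top,
        h.intervalCharPoly_eq_mul hρ (hbc.le.trans hbc.le_top),
        modularCofactor_eq_sum hρ h h' hcover hbc.le_top hc,
        modularCofactor_eq_sum hρ h h' hcover (hbc.le.trans hbc.le_top) hb']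
      exact mul_dvd_mul_right hbc.dvd _
  refine ⟨z ⊔ y, sup_le (hzx.trans h'.le) hyw, (hfirst y hchain hy).trans
    (h'.lift_chain hρ hyw hy hw hchain'), ?_, ?_⟩
  · rw [← inf_eq_right.2 hp, ← inf_assoc, h'.sup_inf_eq hρ hyw hy hzx, hz]
  · rw [h'.rank_sup hρ hyw hy hzx]
    rw [hw] at hrank
    omega

/-- Divisional complements of `x` arising from an atom outside of `x` and a modular coatom. -/
theorem HasDivisionalComplement.of_coatom (hρ : IsSemimodularRank ρ) {w t x e : L}
    (ht : IsModularBelow ρ w t) (hrt : ρ w = ρ t + 1) (hx : IsModularBelow ρ w x)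
    (hew : e ≤ w) (hre : ρ e = 1) (hex : ¬ e ≤ x) (het : ¬ e ≤ t)
    (h : HasDivisionalComplement ρ t ((x ⊔ e) ⊓ t)) : HasDivisionalComplement ρ w x := by
  have hinf : ∀ y, ¬ e ≤ y → e ⊓ y = ⊥ := by
    intro y hy
    by_contra hne
    have h1 := hρ.strictMono (bot_lt_iff_ne_bot.2 hne)
    have h2 : e ⊓ y < e := lt_of_le_of_ne inf_le_left fun h ↦ hy (inf_eq_left.1 h)
    have h3 := hρ.strictMono h2
    rw [hρ.bot] at h1
    omega
  have hex' := hinf x hex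
  have het' := hinf t het
  have hrank := ht.rank_sup hρ hew het' le_rfl
  have hw : t ⊔ e = w := by
    by_contra hne
    have := hρ.strictMono (lt_of_le_of_ne (sup_le ht.le hew) hne)
    omega
  obtain ⟨z, hzt, hchain, hz, hrz⟩ := h
  -- `[e, w]` is isomorphic to `[⊥, t]`, whose polynomial divides that of `[⊥, w]` because `t` is
  -- modular.
  have hfirst : DivisionalStep ρ w ⊥ e := by
    refine ⟨bot_le, hew, by rw [hρ.bot, hre], ?_⟩
    have h1 := ht.intervalCharPoly_sup hρ hew het' bot_le le_rfl
    rw [bot_sup_eq, hw] at h1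
    rw [← h1, ht.intervalCharPoly_eq_mul hρ bot_le]
    exact dvd_mul_right _ _
  refine ⟨z ⊔ e, sup_le (hzt.trans ht.le) hew,
    (ReflTransGen.single hfirst).trans (ht.lift_chain hρ hew het' hw hchain), ?_, ?_⟩
  -- An element above `e` is recovered from its trace on `t`; here the trace is `z ⊓ (x ⊔ e) = ⊥`.
  · have h1 : (z ⊔ e) ⊓ (x ⊔ e) = e := by
      rw [← ht.inf_sup_eq hρ hew het' (z := (z ⊔ e) ⊓ (x ⊔ e)) (le_inf le_sup_right le_sup_right)
        (inf_le_left.trans (sup_le_sup_right hzt _)), inf_right_comm,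
        ht.sup_inf_eq hρ hew het' hzt]
      have : z ⊓ (x ⊔ e) = ⊥ := by
        rw [← hz, inf_comm (x ⊔ e), ← inf_assoc, inf_eq_left.2 hzt]
      rw [this, bot_sup_eq]
    calc (z ⊔ e) ⊓ x = (z ⊔ e) ⊓ (x ⊔ e) ⊓ x := by
          rw [inf_assoc, inf_eq_right.2 (le_sup_left : x ≤ x ⊔ e)]
      _ = ⊥ := by rw [h1, hex']
  -- The projection `(x ⊔ e) ⊓ t` has the same rank as `x`, as both span `x ⊔ e` together with `e`.
  · have h1 := ht.rank_sup hρ hew het' hzt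
    have h2 := ht.rank_sup hρ hew het' (inf_le_right : (x ⊔ e) ⊓ t ≤ t)
    rw [ht.inf_sup_eq hρ hew het' le_sup_right (by rw [hw]; exact sup_le hx.le hew)] at h2
    have h3 := hx.rank_sup hρ hew hex' le_rfl
    omega

/-- In a supersolvable interval, all elements of a class `Full` of modular elements with suitable
closure properties have divisional complements. -/
theorem HasDivisionalComplement.of_supersolvable (hρ : IsSemimodularRank ρ) {Full : L → Prop}
    (hmod : ∀ {x w}, Full x → x ≤ w → IsModularBelow ρ w x)
    (hanti : ∀ {x y}, Full x → y ≤ x → Full y)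
    (hproj : ∀ {x e t w}, Full x → IsModularBelow ρ w t → ρ w = ρ t + 1 → x ≤ w → e ≤ w →
      ρ e = 1 → ¬ e ≤ x → ¬ e ≤ t → Full ((x ⊔ e) ⊓ t))
    (hcover : ∀ {x t w}, x ≤ w → t ≤ w → (∀ e ≤ w, ρ e = 1 → e ≤ t ∨ e ≤ x) →
      ∀ z ≤ w, z ≤ (z ⊓ t) ⊔ (z ⊓ x))
    {n : ℕ} (c : ℕ → L) (hc : Monotone c) (hrank : ∀ i ≤ n, ρ (c i) = i)
    (hcmod : ∀ i ≤ n, IsModularBelow ρ (c n) (c i)) {x : L} (hx : x ≤ c n) (hfull : Full x) :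
    HasDivisionalComplement ρ (c n) x := by
  induction n generalizing x with
  | zero =>
    have h0 : c 0 = ⊥ := by
      by_contra hne
      have := hρ.strictMono (bot_lt_iff_ne_bot.2 hne)
      rw [hrank 0 le_rfl] at this
      omega
    have : x = c 0 := by rw [h0] at hx ⊢; exact le_bot_iff.1 hx
    rw [this]
    exact .self hρ _
  | succ n ih =>
    have ih := @ih (fun i hi ↦ hrank i (by omega)) fun i hi ↦
      (hcmod i (by omega)).mono (hc hi) (hc (Nat.le_succ n))
    have ht := hcmod n (by omega)
    have hrt : ρ (c (n + 1)) = ρ (c n) + 1 := by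
      rw [hrank _ le_rfl, hrank _ (Nat.le_succ n)]
    by_cases hex : ∃ e ≤ c (n + 1), ρ e = 1 ∧ ¬ e ≤ c n ∧ ¬ e ≤ x
    · obtain ⟨e, hew, hre, het, hex⟩ := hex
      exact .of_coatom hρ ht hrt (hmod hfull hx) hew hre hex het
        (ih inf_le_right (hproj hfull ht hrt hx hew hre hex het))
    -- Every atom now lies in `c n` or in `x`. In the join, `x` is a factor that needs only its
    -- trivial complement `⊥` in itself.
    · push Not at hex
      refine .join hρ ht (hmod hfull hx) (hcover hx ht.le fun e he hre ↦ ?_)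
        (ih inf_le_left (hanti hfull inf_le_right)) le_rfl (.self hρ x)
      by_cases h : e ≤ c n
      · exact .inl h
      · exact .inr (hex e he hre h)

end DivisionalChain

/-! ### The lattice of flats -/

namespace Matroid

variable {α : Type*} {M : Matroid α}

theorem IsFlat.inter_isFlat {F G : Set α} (hF : M.IsFlat F) (hG : M.IsFlat G) : M.IsFlat (F ∩ G) := by
  rw [Set.inter_eq_iInter]
  exact IsFlat.iInter fun b ↦ by cases b <;> assumption

theorem IsFlat.closure_subset {F X : Set α} (hF : M.IsFlat F) (hX : X ⊆ F) :
    M.closure X ⊆ F :=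
  (M.closure_subset_closure hX).trans hF.closure.subset

instance lattice_flatLattice (M : Matroid α) : Lattice M.FlatLattice :=
  { (inferInstance : PartialOrder M.FlatLattice) with
    sup := fun F G ↦ ⟨M.closure (F.1 ∪ G.1), M.isFlat_closure _⟩
    inf := fun F G ↦ ⟨F.1 ∩ G.1, F.2.inter_isFlat G.2⟩
    le_sup_left := fun F _ ↦ M.subset_closure_of_subset' Set.subset_union_left F.2.subset_ground
    le_sup_right := fun _ G ↦ M.subset_closure_of_subset' Set.subset_union_right G.2.subset_ground
    sup_le := fun _ _ H hF hG ↦ H.2.closure_subset (Set.union_subset hF hG)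
    inf_le_left := fun _ _ ↦ Set.inter_subset_left
    inf_le_right := fun _ _ ↦ Set.inter_subset_right
    le_inf := fun _ _ _ hF hG ↦ Set.subset_inter hF hG }

instance orderBot_flatLattice (M : Matroid α) : OrderBot M.FlatLattice where
  bot := M.leastFlat
  bot_le F := F.2.closure_subset (Set.empty_subset _)

theorem coe_sup_flat (F G : M.FlatLattice) : (F ⊔ G).1 = M.closure (F.1 ∪ G.1) := rfl

theorem coe_inf_flat (F G : M.FlatLattice) : (F ⊓ G).1 = F.1 ∩ G.1 := rfl

theorem coe_bot_flat : (⊥ : M.FlatLattice).1 = M.closure ∅ := rfl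

/-- The rank of a flat as a natural number. -/
noncomputable def flatRank (M : Matroid α) (F : M.FlatLattice) : ℕ := (M.eRk F.1).toNat

theorem coe_flatRank [M.Finite] (F : M.FlatLattice) : (M.flatRank F : ℕ∞) = M.eRk F.1 :=
  ENat.natCast_toNat (eRk_ne_top_iff.2 (M.isRkFinite_set _))

theorem isSemimodularRank_flatRank (M : Matroid α) [M.Finite] :
    IsSemimodularRank M.flatRank where
  strictMono := by
    intro F G hFG
    rw [← ENat.natCast_lt_natCast, coe_flatRank, coe_flatRank]
    refine lt_of_not_ge fun h ↦ hFG.ne (Subtype.ext ?_)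
    rw [← F.2.closure, ← G.2.closure]
    exact (M.isRkFinite_set _).closure_eq_closure_of_subset_of_eRk_ge_eRk hFG.le h
  bot := by rw [flatRank, coe_bot_flat, eRk_closure_eq, eRk_empty, ENat.toNat_zero]
  submodular F G := by
    rw [← ENat.natCast_le_natCast]
    push_cast
    rw [coe_flatRank, coe_flatRank, coe_flatRank, coe_flatRank, coe_sup_flat, coe_inf_flat,
      eRk_closure_eq]
    exact M.eRk_inter_add_eRk_union_le _ _

/-- A flat is below the join of its parts in two flats that contain all its elements. -/
theorem le_inf_sup_inf {F G z : M.FlatLattice} (h : z.1 ⊆ F.1 ∪ G.1) :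
    z ≤ (z ⊓ F) ⊔ (z ⊓ G) := by
  intro e he
  refine M.mem_closure_of_mem' ?_ (z.2.subset_ground he)
  rcases h he with h' | h'
  · exact .inl ⟨he, h'⟩
  · exact .inr ⟨he, h'⟩

/-- The flat spanned by a single element. -/
def pointFlat (M : Matroid α) (e : α) : M.FlatLattice := ⟨M.closure {e}, M.isFlat_closure _⟩

theorem pointFlat_le {e : α} (he : e ∈ M.E) {F : M.FlatLattice} : M.pointFlat e ≤ F ↔ e ∈ F.1 :=
  ⟨fun h ↦ h (M.mem_closure_of_mem' rfl he),
    fun h ↦ F.2.closure_subset (Set.singleton_subset_iff.2 h)⟩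

theorem exists_eq_pointFlat [M.Finite] {F : M.FlatLattice} {G : M.FlatLattice}
    (hF : M.flatRank F = 1)
    (hFG : ¬ F ≤ G) : ∃ e ∈ M.E, e ∉ G.1 ∧ M.pointFlat e = F := by
  obtain ⟨e, heF, heG⟩ := Set.not_subset.1 hFG
  have heE := F.2.subset_ground heF
  refine ⟨e, heE, heG, ?_⟩
  have hle : M.pointFlat e ≤ F := (pointFlat_le heE).2 heF
  by_contra hne
  have h1 := (isSemimodularRank_flatRank M).strictMono (lt_of_le_of_ne hle hne)
  have h2 : (⊥ : M.FlatLattice) < M.pointFlat e := by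
    refine bot_lt_iff_ne_bot.2 fun h ↦ heG ?_
    exact (pointFlat_le heE).1 (h.le.trans bot_le)
  have h3 := (isSemimodularRank_flatRank M).strictMono h2
  omega

theorem flatRank_pointFlat [M.Finite] {e : α} (he : e ∈ M.E) {G : M.FlatLattice} (heG : e ∉ G.1) :
    M.flatRank (M.pointFlat e) = 1 := by
  have h1 : (⊥ : M.FlatLattice) < M.pointFlat e := by
    refine bot_lt_iff_ne_bot.2 fun h ↦ heG ?_
    exact (pointFlat_le he).1 (h.le.trans bot_le)
  have h2 := (isSemimodularRank_flatRank M).strictMono h1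
  have h3 : M.flatRank (M.pointFlat e) ≤ 1 := by
    rw [← ENat.natCast_le_natCast, coe_flatRank, pointFlat, eRk_closure_eq]
    exact M.eRk_singleton_le e
  omega

theorem inf_sup_inf_of_atoms [M.Finite] {x t w : M.FlatLattice}
    (h : ∀ e ≤ w, M.flatRank e = 1 → e ≤ t ∨ e ≤ x) {z : M.FlatLattice} (hz : z ≤ w) :
    z ≤ (z ⊓ t) ⊔ (z ⊓ x) := by
  refine le_inf_sup_inf fun e he ↦ ?_
  have heE := z.2.subset_ground he
  by_cases hex : e ∈ x.1
  · exact .inr hex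
  · have h1 := h (M.pointFlat e) ((pointFlat_le heE).2 (hz he)) (flatRank_pointFlat heE hex)
    rwa [pointFlat_le heE, pointFlat_le heE] at h1

/-! ### Full flats of represented matroids -/

section Representation

variable {K V : Type*} [Field K] [AddCommGroup V] [Module K V] {v : α → V}

open Submodule

/-- `v` represents the matroid `M`. -/
def IsRep (K : Type*) [Field K] {V : Type*} [AddCommGroup V] [Module K V] (M : Matroid α)
    (v : α → V) : Prop :=
  ∀ I ⊆ M.E, (M.Indep I ↔ LinearIndepOn K v I)

theorem IsRep.mem_closure_iff_of_indep (hv : M.IsRep K v) {I : Set α} (hI : M.Indep I) {e : α}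
    (he : e ∈ M.E) : e ∈ M.closure I ↔ v e ∈ span K (v '' I) := by
  rw [hI.mem_closure_iff', hv _ (Set.insert_subset he hI.subset_ground), linearIndepOn_insert_iff]
  have h1 := (hv I hI.subset_ground).1 hI
  have h2 : e ∈ I → v e ∈ span K (v '' I) := fun h ↦ subset_span (Set.mem_image_of_mem v h)
  tauto

theorem IsRep.span_eq_of_isBasis (hv : M.IsRep K v) {I X : Set α} (hI : M.IsBasis I X) :
    span K (v '' I) = span K (v '' X) := by
  refine le_antisymm (span_mono (Set.image_mono hI.subset)) (span_le.2 ?_)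
  rintro _ ⟨x, hx, rfl⟩
  exact (hv.mem_closure_iff_of_indep hI.indep (hI.subset_ground hx)).1 (hI.subset_closure hx)

theorem IsRep.mem_closure_iff (hv : M.IsRep K v) {X : Set α} (hX : X ⊆ M.E) {e : α}
    (he : e ∈ M.E) : e ∈ M.closure X ↔ v e ∈ span K (v '' X) := by
  obtain ⟨I, hI⟩ := M.exists_isBasis X
  rw [← hI.closure_eq_closure, hv.mem_closure_iff_of_indep hI.indep he, hv.span_eq_of_isBasis hI]

theorem IsRep.mem_flat_iff (hv : M.IsRep K v) (F : M.FlatLattice) {e : α} (he : e ∈ M.E) :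
    e ∈ F.1 ↔ v e ∈ span K (v '' F.1) := by
  rw [← hv.mem_closure_iff F.2.subset_ground he, F.2.closure]

theorem IsRep.span_closure (hv : M.IsRep K v) {X : Set α} (hX : X ⊆ M.E) :
    span K (v '' M.closure X) = span K (v '' X) := by
  refine le_antisymm (span_le.2 ?_) (span_mono (Set.image_mono (M.subset_closure X)))
  rintro _ ⟨x, hx, rfl⟩
  exact (hv.mem_closure_iff hX (M.closure_subset_ground _ hx)).1 hx

theorem IsRep.span_sup (hv : M.IsRep K v) (F G : M.FlatLattice) :
    span K (v '' (F ⊔ G).1) = span K (v '' F.1) ⊔ span K (v '' G.1) := by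
  rw [coe_sup_flat, hv.span_closure (Set.union_subset F.2.subset_ground G.2.subset_ground),
    Set.image_union, span_union]

theorem IsRep.flatRank_eq [M.Finite] (hv : M.IsRep K v) (F : M.FlatLattice) :
    M.flatRank F = Module.finrank K (span K (v '' F.1)) := by
  obtain ⟨I, hI⟩ := M.exists_isBasis F.1 F.2.subset_ground
  have hfin : I.Finite := M.ground_finite.subset hI.indep.subset_ground
  have hlin := (hv I hI.indep.subset_ground).1 hI.indep
  have : Fintype I := hfin.fintype
  rw [flatRank, hI.eRk_eq_encard, ← hv.span_eq_of_isBasis hI, Set.image_eq_range,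
    finrank_span_eq_card hlin, Set.encard, ENat.card_eq_coe_fintype_card, ENat.toNat_natCast]

/-- A flat is full if its elements represent all points of the subspace they span. -/
def IsFullFlat (K : Type*) [Field K] {V : Type*} [AddCommGroup V] [Module K V] (v : α → V)
    (F : M.FlatLattice) : Prop :=
  ∀ w ∈ span K (v '' F.1), w ≠ 0 → ∃ x ∈ F.1, ∃ c : K, w = c • v x

theorem IsFullFlat.anti (hv : M.IsRep K v) {F G : M.FlatLattice} (hF : IsFullFlat K v F)
    (hG : G ≤ F) : IsFullFlat K v G := by
  intro w hw hw0
  obtain ⟨x, hx, c, rfl⟩ := hF w (span_mono (Set.image_mono hG) hw) hw0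
  have hc : c ≠ 0 := by rintro rfl; simp at hw0
  exact ⟨x, (hv.mem_flat_iff G (F.2.subset_ground hx)).2 ((smul_mem_iff _ hc).1 hw), c, rfl⟩

theorem isFullFlat_bot (hv : M.IsRep K v) : IsFullFlat K v (⊥ : M.FlatLattice) := by
  intro w hw hw0
  rw [coe_bot_flat, hv.span_closure (Set.empty_subset _), Set.image_empty, span_empty] at hw
  exact absurd ((mem_bot K).1 hw) hw0

/-- Fullness forces the span of `F ∩ G` to be the intersection of the spans, so modularity is the
dimension formula. -/
theorem IsFullFlat.isModularBelow [M.Finite] (hv : M.IsRep K v) {F w : M.FlatLattice}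
    (hF : IsFullFlat K v F) (hw : F ≤ w) : IsModularBelow M.flatRank w F := by
  refine ⟨hw, fun G _ ↦ ?_⟩
  have hinf : span K (v '' (F ⊓ G).1) = span K (v '' F.1) ⊓ span K (v '' G.1) := by
    refine le_antisymm (le_inf (span_mono (Set.image_mono Set.inter_subset_left))
      (span_mono (Set.image_mono Set.inter_subset_right))) ?_
    rintro w ⟨h1, h2⟩
    by_cases hw0 : w = 0
    · rw [hw0]; exact zero_mem _
    obtain ⟨x, hx, c, rfl⟩ := hF w h1 hw0
    have hc : c ≠ 0 := by rintro rfl; simp at hw0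
    have hxG := (hv.mem_flat_iff G (F.2.subset_ground hx)).2 ((smul_mem_iff _ hc).1 h2)
    exact smul_mem _ _ (subset_span (Set.mem_image_of_mem v ⟨hx, hxG⟩))
  rw [hv.flatRank_eq, hv.flatRank_eq, hv.flatRank_eq, hv.flatRank_eq, hinf, hv.span_sup]
  have : FiniteDimensional K (span K (v '' F.1)) :=
    FiniteDimensional.span_of_finite K ((M.ground_finite.subset F.2.subset_ground).image v)
  have : FiniteDimensional K (span K (v '' G.1)) :=
    FiniteDimensional.span_of_finite K ((M.ground_finite.subset G.2.subset_ground).image v)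
  rw [← finrank_sup_add_finrank_inf_eq, add_comm]

/-- A full flat that is covered by two flats lies in one of them. -/
theorem IsFullFlat.le_or_le (hv : M.IsRep K v) {F G H : M.FlatLattice} (hF : IsFullFlat K v F)
    (h : F.1 ⊆ G.1 ∪ H.1) : F ≤ G ∨ F ≤ H := by
  by_contra! hcon
  obtain ⟨e, heF, heG⟩ := Set.not_subset.1 hcon.1
  obtain ⟨f, hfF, hfH⟩ := Set.not_subset.1 hcon.2
  have heE := F.2.subset_ground heF
  have hfE := F.2.subset_ground hfF
  have heH := (hv.mem_flat_iff H heE).1 ((h heF).resolve_left heG)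
  have hfG := (hv.mem_flat_iff G hfE).1 ((h hfF).resolve_right hfH)
  rw [hv.mem_flat_iff G heE] at heG
  rw [hv.mem_flat_iff H hfE] at hfH
  -- The sum lies in neither of the two subspaces, yet fullness represents it by an element of `F`.
  have hmem : v e + v f ∈ span K (v '' F.1) :=
    add_mem (subset_span (Set.mem_image_of_mem v heF)) (subset_span (Set.mem_image_of_mem v hfF))
  have hG : v e + v f ∉ span K (v '' G.1) := fun h ↦ heG ((add_mem_cancel_right hfG).1 h)
  have hH : v e + v f ∉ span K (v '' H.1) := fun h ↦ hfH ((add_mem_cancel_left heH).1 h)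
  obtain ⟨g, hg, c, hc⟩ := hF _ hmem fun h0 ↦ hG (h0 ▸ zero_mem _)
  rw [hc] at hG hH
  rcases h hg with h' | h'
  · exact hG (smul_mem _ _ (subset_span (Set.mem_image_of_mem v h')))
  · exact hH (smul_mem _ _ (subset_span (Set.mem_image_of_mem v h')))

/-- The projection of a full flat from a point to a modular coatom is full. -/
theorem IsFullFlat.proj [M.Finite] (hv : M.IsRep K v) {x e t w : M.FlatLattice}
    (hx : IsFullFlat K v x)
    (ht : IsModularBelow M.flatRank w t) (hrt : M.flatRank w = M.flatRank t + 1) (hxw : x ≤ w)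
    (hew : e ≤ w) (hre : M.flatRank e = 1) (hex : ¬ e ≤ x) (het : ¬ e ≤ t) :
    IsFullFlat K v ((x ⊔ e) ⊓ t) := by
  have hρ := isSemimodularRank_flatRank M
  obtain ⟨p, hpE, hpt, rfl⟩ := exists_eq_pointFlat hre het
  rw [pointFlat_le hpE] at hex
  have hspan_p : span K (v '' (M.pointFlat p).1) = span K {v p} := by
    rw [pointFlat, hv.span_closure (Set.singleton_subset_iff.2 hpE), Set.image_singleton]
  rw [hv.mem_flat_iff t hpE] at hpt
  intro u hu hu0
  have hut : u ∈ span K (v '' t.1) := span_mono (Set.image_mono Set.inter_subset_right) hu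
  have huxp : u ∈ span K (v '' x.1) ⊔ span K {v p} := by
    rw [← hspan_p, ← hv.span_sup]
    exact span_mono (Set.image_mono Set.inter_subset_left) hu
  obtain ⟨u', hu', q, hq, rfl⟩ := mem_sup.1 huxp
  obtain ⟨b, rfl⟩ := mem_span_singleton.1 hq
  have hu'0 : u' ≠ 0 := by
    rintro rfl
    rw [zero_add] at hut hu0
    have hb : b ≠ 0 := by rintro rfl; simp at hu0
    exact hpt ((smul_mem_iff _ hb).1 hut)
  obtain ⟨g, hg, a, rfl⟩ := hx u' hu' hu'0
  have ha : a ≠ 0 := by rintro rfl; simp at hu'0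
  have hgE := x.2.subset_ground hg
  have hgx : M.pointFlat g ≤ x := (pointFlat_le hgE).2 hg
  have hspan_g : span K (v '' (M.pointFlat g).1) = span K {v g} := by
    rw [pointFlat, hv.span_closure (Set.singleton_subset_iff.2 hgE), Set.image_singleton]
  have hline : M.pointFlat p < M.pointFlat g ⊔ M.pointFlat p := by
    refine lt_of_le_of_ne le_sup_right fun h ↦ hex ?_
    have hgp : g ∈ (M.pointFlat p).1 := by
      rw [h]; exact (pointFlat_le hgE).1 le_sup_left
    rw [hv.mem_flat_iff _ hgE, hspan_p, mem_span_singleton] at hgp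
    obtain ⟨d, hd⟩ := hgp
    have hd0 : d ≠ 0 := by rintro rfl; rw [zero_smul] at hd; simp [← hd] at hu'0
    rw [hv.mem_flat_iff _ hpE, ← smul_mem_iff _ hd0, hd]
    exact subset_span (Set.mem_image_of_mem v hg)
  have hlw : M.pointFlat g ⊔ M.pointFlat p ≤ w := sup_le (hgx.trans hxw) hew
  -- The flat through `g` and `p` has rank at least two, too much to avoid a modular coatom.
  have hmeet : (M.pointFlat g ⊔ M.pointFlat p) ⊓ t ≠ ⊥ := by
    intro h
    have h1 := ht.rank_sup hρ hlw h le_rfl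
    have h2 := hρ.strictMono.monotone (sup_le ht.le hlw)
    have h3 := hρ.strictMono hline
    omega
  obtain ⟨y, hyl, hyt, hy0⟩ : ∃ y ∈ (M.pointFlat g ⊔ M.pointFlat p).1, y ∈ t.1 ∧ v y ≠ 0 := by
    have h1 : ¬ (M.pointFlat g ⊔ M.pointFlat p) ⊓ t ≤ ⊥ := fun h ↦ hmeet (le_bot_iff.1 h)
    obtain ⟨y, hy, hy'⟩ := Set.not_subset.1 h1
    refine ⟨y, hy.1, hy.2, fun h0 ↦ hy' ?_⟩
    rw [hv.mem_flat_iff _ (t.2.subset_ground hy.2), h0]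
    exact zero_mem _
  have hyE := t.2.subset_ground hyt
  have hyspan := (hv.mem_flat_iff _ hyE).1 hyl
  rw [hv.span_sup, hspan_g, hspan_p] at hyspan
  obtain ⟨_, h1, _, h2, hy⟩ := mem_sup.1 hyspan
  obtain ⟨a', rfl⟩ := mem_span_singleton.1 h1
  obtain ⟨b', rfl⟩ := mem_span_singleton.1 h2
  have hyt' := (hv.mem_flat_iff t hyE).1 hyt
  have ha' : a' ≠ 0 := by
    rintro rfl
    rw [zero_smul, zero_add] at hy
    have hb : b' ≠ 0 := by rintro rfl; simp [eq_comm, hy0] at hy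
    rw [← hy] at hyt'
    exact hpt ((smul_mem_iff _ hb).1 hyt')
  refine ⟨y, ⟨(sup_le_sup_right hgx _ : _ ≤ x ⊔ M.pointFlat p) hyl, hyt⟩, a / a', ?_⟩
  -- Subtracting this multiple of `v y` cancels `v g`. The remaining multiple of `v p` lies in the
  -- span of `t`, which omits `v p`, so it is zero.
  have hmem : (b - a / a' * b') • v p ∈ span K (v '' t.1) := by
    have : (b - a / a' * b') • v p = (a • v g + b • v p) - (a / a') • v y := by
      rw [← hy, smul_add, smul_smul, smul_smul, div_mul_cancel₀ _ ha', sub_smul]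
      abel
    rw [this]
    exact sub_mem hut (smul_mem _ _ hyt')
  have hb : b - a / a' * b' = 0 := by
    by_contra hne
    exact hpt ((smul_mem_iff _ hne).1 hmem)
  rw [← hy, smul_add, smul_smul, smul_smul, div_mul_cancel₀ _ ha', ← sub_eq_zero.1 hb]

end Representation

end Matroid

/-! ### Projective geometries are full -/

namespace Matroid

variable {α : Type*} {M : Matroid α}

/-- A counting argument: the isomorphism supplies only a rank bound and the number of points. The
rank bound embeds the span of `F` linearly into the dual of `K ^ k`, and kernels turn nonzero
vectors, up to scalars, into hyperplanes. On `F` this is injective by simplicity, hence onto, so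
every nonzero vector is proportional to some `v x`. -/
theorem isFullFlat_of_isIsomorphicTo_projectiveGeometry {K V : Type*} [Field K] [Finite K]
    [AddCommGroup V] [Module K V] [M.Finite] {v : α → V} (hv : M.IsRep K v) {F : M.FlatLattice}
    (hsimple : ∀ e ∈ F.1, ∀ f ∈ F.1, M.Indep {e, f}) {k : ℕ}
    (hF : (M.restrict F.1).IsIsomorphicTo (projectiveGeometry K k)) : IsFullFlat K v F := by
  obtain ⟨φ, hφ⟩ := hF
  have hFfin : F.1.Finite := M.ground_finite.subset F.2.subset_ground
  have hrank : Module.finrank K (Submodule.span K (v '' F.1)) ≤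
      Module.finrank K (Module.Dual K (Fin k → K)) := by
    rw [Subspace.dual_finrank_eq, ← hv.flatRank_eq F]
    obtain ⟨I, hI⟩ := M.exists_isBasis F.1 F.2.subset_ground
    have h1 : Subtype.val '' (Subtype.val ⁻¹' I : Set (M.restrict F.1).E) = I := by
      rw [Subtype.image_preimage_coe]
      exact Set.inter_eq_right.2 hI.subset
    -- A basis of `F` becomes an independent set of hyperplanes, whose size is a codimension in `K ^
    -- k`.
    have h2 := (hφ (Subtype.val ⁻¹' I)).1 (by
      rw [h1]; exact restrict_indep_iff.2 ⟨hI.indep, hI.subset⟩)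
    have h3 : Module.finrank K ((Fin k → K) ⧸ sInf _) = Set.ncard _ := h2.2
    rw [Set.ncard_image_of_injective _ Subtype.val_injective,
      Set.ncard_image_of_injective _ φ.injective, ← Set.ncard_image_of_injective _
      Subtype.val_injective, h1] at h3
    rw [flatRank, hI.eRk_eq_encard, ← Set.ncard_def, ← h3]
    exact Submodule.finrank_quotient_le _
  have hfd : FiniteDimensional K (Submodule.span K (v '' F.1)) :=
    FiniteDimensional.span_of_finite K (hFfin.image v)
  obtain ⟨g, hg⟩ := finrank_le_iff_exists_linearMap.1 hrank
  have hker : ∀ w w', LinearMap.ker (g w) = LinearMap.ker (g w') → ∃ c : K, w = c • w' := by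
    intro w w' h
    have h1 := mem_span_of_iInf_ker_le_ker (L := fun _ : Unit ↦ g w') (K := g w) (by simp [h])
    rw [Set.range_const, Submodule.mem_span_singleton] at h1
    obtain ⟨c, hc⟩ := h1
    exact ⟨c, hg (by rw [map_smul, hc])⟩
  have hcodim : ∀ w, w ≠ 0 →
      LinearMap.ker (g w) ∈ (HyperplaneArrangement.allHyperplanes K k).hyperplanes := by
    intro w hw
    have hgw : g w ≠ 0 := fun h ↦ hw (hg (by rw [h, map_zero]))
    have h1 := Module.Dual.finrank_ker_add_one_of_ne_zero hgw
    have h2 := Submodule.finrank_quotient_add_finrank (LinearMap.ker (g w))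
    change Module.finrank K ((Fin k → K) ⧸ LinearMap.ker (g w)) = 1
    omega
  have hv0 : ∀ x ∈ F.1, v x ≠ 0 := by
    intro x hx
    have h1 := (hv _ (by simpa using F.2.subset_ground hx)).1 (hsimple x hx x hx)
    exact h1.ne_zero (Set.mem_insert _ _)
  let vF : F.1 → Submodule.span K (v '' F.1) := fun x ↦
    ⟨v x, Submodule.subset_span (Set.mem_image_of_mem v x.2)⟩
  let ψ : F.1 → (projectiveGeometry K k).E := fun x ↦
    ⟨LinearMap.ker (g (vF x)), hcodim _ fun h ↦ hv0 x x.2 (congrArg Subtype.val h)⟩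
  have hψ : Function.Injective ψ := by
    intro x y hxy
    obtain ⟨c, hc⟩ := hker (vF x) (vF y) (congrArg Subtype.val hxy)
    by_contra hne
    have h1 := (hv _ (Set.insert_subset (F.2.subset_ground x.2)
      (Set.singleton_subset_iff.2 (F.2.subset_ground y.2)))).1 (hsimple x x.2 y y.2)
    have hne' : (x : α) ∉ ({(y : α)} : Set α) := fun h ↦ hne (Subtype.ext h)
    refine ((linearIndepOn_insert hne').1 h1).2 ?_
    rw [Set.image_singleton, Submodule.mem_span_singleton]
    exact ⟨c, (congrArg Subtype.val hc).symm⟩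
  have : Finite F.1 := hFfin
  have hsurj : Function.Surjective ψ := hψ.surjective_of_finite φ
  intro w hw hw0
  have hw0' : (⟨w, hw⟩ : Submodule.span K (v '' F.1)) ≠ 0 := fun h ↦ hw0 (congrArg Subtype.val h)
  obtain ⟨x, hx⟩ := hsurj ⟨_, hcodim ⟨w, hw⟩ hw0'⟩
  obtain ⟨c, hc⟩ := hker ⟨w, hw⟩ (vF x) (congrArg Subtype.val hx).symm
  exact ⟨x, x.2, c, congrArg Subtype.val hc⟩

/-! ### Characteristic polynomials of contractions -/

theorem eRk_contract_add_eRk (M : Matroid α) {X Y : Set α} (hX : X ⊆ M.E \ Y) (hY : Y ⊆ M.E) :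
    (M ／ Y).eRk X + M.eRk Y = M.eRk (X ∪ Y) := by
  obtain ⟨J, hJ⟩ := M.exists_isBasis Y
  obtain ⟨I, hI⟩ := (M ／ Y).exists_isBasis X
  obtain ⟨hIJ, hdj⟩ := hJ.contract_indep_iff.1 hI.indep
  have hbasis : M.IsBasis (I ∪ J) (X ∪ Y) := by
    rw [isBasis_iff_indep_subset_closure]
    refine ⟨hIJ, Set.union_subset_union hI.subset hJ.subset, ?_⟩
    have h1 : M.closure (I ∪ J) = M.closure (I ∪ Y) := by
      rw [← closure_union_closure_right_eq, hJ.closure_eq_closure, closure_union_closure_right_eq]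
    rw [h1]
    refine Set.union_subset ?_ (M.subset_closure_of_subset' Set.subset_union_right hY)
    have h2 := hI.subset_closure
    rw [contract_closure_eq] at h2
    exact h2.trans Set.sdiff_subset
  rw [hI.eRk_eq_encard, hJ.eRk_eq_encard, hbasis.eRk_eq_encard, Set.encard_union_eq]
  exact hdj.symm.mono_right hJ.subset

/-- The ground set as a flat. -/
def topFlat (M : Matroid α) : M.FlatLattice := ⟨M.E, M.ground_isFlat⟩

open Classical in
theorem charPoly_eq_intervalCharPoly (M : Matroid α) [M.Finite] :
    M.charPoly = intervalCharPoly M.flatRank ⊥ M.topFlat := by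
  have huniv : Finset.Icc (⊥ : M.FlatLattice) M.topFlat = Finset.univ := by
    ext F
    rw [Finset.mem_Icc]
    exact iff_of_true ⟨bot_le, F.2.subset_ground⟩ (Finset.mem_univ F)
  rw [charPoly, intervalCharPoly, huniv]
  refine Finset.sum_congr rfl fun F _ ↦ ?_
  rw [flatMobius, flatRank, flatRank, topFlat, eRk_ground,
    ENat.toNat_sub (eRk_ne_top_iff.2 (M.isRkFinite_set _))]
  rfl

theorem IsFlat.union_of_contract {Y G : Set α} (hY : Y ⊆ M.E) (hG : (M ／ Y).IsFlat G) :
    M.IsFlat (G ∪ Y) := by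
  have h1 := hG.closure
  rw [contract_closure_eq] at h1
  have h2 : Y ⊆ M.closure (G ∪ Y) := M.subset_closure_of_subset' Set.subset_union_right hY
  have h3 : M.closure (G ∪ Y) = G ∪ Y := by
    conv_rhs => rw [← h1, Set.sdiff_union_of_subset h2]
  rw [← h3]
  exact M.isFlat_closure _

open Classical in
-- Adding `Y` identifies the flats of the contraction with the flats above `Y`, lowering ranks by
-- that of `Y`.
theorem charPoly_contract (M : Matroid α) [M.Finite] (Y : M.FlatLattice) :
    (M ／ Y.1).charPoly = intervalCharPoly M.flatRank Y M.topFlat := by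
  have hYE := Y.2.subset_ground
  let g : (M ／ Y.1).FlatLattice → M.FlatLattice := fun G ↦ ⟨G.1 ∪ Y.1, G.2.union_of_contract hYE⟩
  have hdisj : ∀ G : (M ／ Y.1).FlatLattice, Disjoint G.1 Y.1 := fun G ↦
    (Set.subset_sdiff.1 G.2.subset_ground).2
  have hbot : g ⊥ = Y := by
    refine Subtype.ext ?_
    change (M ／ Y.1).closure ∅ ∪ Y.1 = Y.1
    rw [contract_closure_eq, Set.empty_union, Y.2.closure, sdiff_self]
    exact Set.empty_union _
  have htop : g (M ／ Y.1).topFlat = M.topFlat :=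
    Subtype.ext (Set.sdiff_union_of_subset hYE)
  have hle : ∀ G H, g G ≤ g H ↔ G ≤ H := by
    intro G H
    refine ⟨fun h e he ↦ ?_, fun h ↦ Set.union_subset_union_left _ h⟩
    exact (h (Or.inl he)).resolve_right (Set.disjoint_left.1 (hdisj G) he)
  have hrank : ∀ G, (M ／ Y.1).flatRank G + M.flatRank Y = M.flatRank (g G) := by
    intro G
    have := M.eRk_contract_add_eRk G.2.subset_ground hYE
    have h2 : M.eRk (G.1 ∪ Y.1) = M.flatRank (g G) := (coe_flatRank (g G)).symm
    rw [h2, ← coe_flatRank, ← coe_flatRank] at this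
    exact_mod_cast this
  have hsurj : ∀ H, Y ≤ H → ∃ G, g G = H := by
    intro H hYH
    have hYH : Y.1 ⊆ H.1 := hYH
    have hflat : (M ／ Y.1).IsFlat (H.1 \ Y.1) := by
      rw [isFlat_iff_closure_eq, contract_closure_eq, Set.sdiff_union_of_subset hYH, H.2.closure]
    exact ⟨⟨_, hflat⟩, Subtype.ext (Set.sdiff_union_of_subset hYH)⟩
  clear_value g
  have h1 := charPoly_eq_intervalCharPoly (M ／ Y.1)
  rw [h1]
  conv_rhs => rw [← hbot, ← htop]
  refine intervalCharPoly_eq_of_bijOn (g := g) bot_le (fun G _ ↦ ⟨?_, ?_, ?_⟩) fun G hG ↦ ?_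
  · exact fun H hH ↦ ⟨(hle _ _).2 hH.1, (hle _ _).2 hH.2⟩
  · intro H _ H' _ h
    exact le_antisymm ((hle _ _).1 h.le) ((hle _ _).1 h.ge)
  · intro H hH
    obtain ⟨G, rfl⟩ := hsurj H (hbot ▸ hH.1)
    exact ⟨G, ⟨(hle _ _).1 hH.1, (hle _ _).1 hH.2⟩, rfl⟩
  · have h1 := hrank G
    have h2 := hrank (M ／ Y.1).topFlat
    omega

/-! ### Divisional flags -/

theorem _root_.Relation.ReflTransGen.exists_seq {L : Type*} {r : L → L → Prop} {a b : L}
    (h : Relation.ReflTransGen r a b) :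
    ∃ (n : ℕ) (f : ℕ → L), f 0 = a ∧ f n = b ∧ ∀ i < n, r (f i) (f (i + 1)) := by
  induction h with
  | refl => exact ⟨0, fun _ ↦ a, rfl, rfl, fun i hi ↦ absurd hi (Nat.not_lt_zero i)⟩
  | @tail b c _ hbc ih =>
    obtain ⟨n, f, h0, hn, hf⟩ := ih
    refine ⟨n + 1, fun i ↦ if i ≤ n then f i else c, by simpa using h0, by simp, fun i hi ↦ ?_⟩
    rcases Nat.lt_succ_iff_lt_or_eq.1 hi with h | rfl
    · simpa [h.le, Nat.succ_le_of_lt h] using hf i h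
    · simpa [hn] using hbc

open Classical in
theorem hasDivisionalFlag_of_chain [M.Finite] (hM : M.closure ∅ = ∅)
    (h : Relation.ReflTransGen (DivisionalStep M.flatRank M.topFlat) ⊥ M.topFlat) :
    M.HasDivisionalFlag := by
  obtain ⟨n, f, h0, hn, hf⟩ := h.exists_seq
  have hrank : ∀ i ≤ n, M.flatRank (f i) = i := by
    intro i
    induction i with
    | zero => intro _; rw [h0, (isSemimodularRank_flatRank M).bot]
    | succ i ih => intro hi; rw [(hf i hi).rank, ih (by omega)]
  refine ⟨n, fun i ↦ (f i).1, ⟨fun i ↦ (f i).2, ?_, ?_, ?_, ?_⟩, fun i ↦ ?_⟩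
  · change (f 0).1 = ∅
    rw [h0, coe_bot_flat, hM]
  · change (f n).1 = M.E
    rw [hn, topFlat]
  · exact Fin.monotone_iff_le_succ.2 fun i ↦ (hf i i.2).le
  · intro i
    rw [← coe_flatRank, hrank i (by omega)]
  · change (M ／ (f (i + 1)).1).charPoly ∣ (M ／ (f i).1).charPoly
    rw [charPoly_contract, charPoly_contract]
    exact (hf i i.2).dvd

/-! ### Restrictions to flats -/

theorem isFlat_of_restrict {T F : Set α} (hT : M.IsFlat T) (hF : (M.restrict T).IsFlat F) :
    M.IsFlat F := by
  have hFT : F ⊆ T := hF.subset_ground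
  have h1 := hF.closure
  rw [M.restrict_closure_eq hFT hT.subset_ground,
    Set.inter_eq_left.2 (hT.closure_subset hFT)] at h1
  rw [← h1]
  exact M.isFlat_closure _

theorem IsFlat.restrict_of_subset {T F : Set α} (hT : M.IsFlat T) (hF : M.IsFlat F) (hFT : F ⊆ T) :
    (M.restrict T).IsFlat F := by
  rw [isFlat_iff_closure_eq, M.restrict_closure_eq hFT hT.subset_ground, hF.closure,
    Set.inter_eq_left.2 hFT]

/-- Flats of the restriction to a flat `T` are the flats of `M` below `T`, so all factors can be
treated inside one ambient lattice. -/
theorem IsModularFlat.isModularBelow [M.Finite] {T : M.FlatLattice} {F : Set α}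
    (hF : (M.restrict T.1).IsModularFlat F) :
    IsModularBelow M.flatRank T ⟨F, isFlat_of_restrict T.2 hF.1⟩ := by
  have hFT : F ⊆ T.1 := hF.1.subset_ground
  refine ⟨hFT, fun G hG ↦ ?_⟩
  have hG' : G.1 ⊆ T.1 := hG
  have hFG := Set.union_subset hFT hG'
  have h1 := hF.2 G.1 (T.2.restrict_of_subset G.2 hG')
  rw [M.restrict_closure_eq hFG T.2.subset_ground, Set.inter_eq_left.2 (T.2.closure_subset hFG),
    M.restrict_eRk_eq hFT, M.restrict_eRk_eq hG',
    M.restrict_eRk_eq (Set.inter_subset_left.trans hFT),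
    M.restrict_eRk_eq (T.2.closure_subset hFG)] at h1
  rw [← ENat.natCast_inj]
  push_cast
  rw [coe_flatRank, coe_flatRank, coe_flatRank, coe_flatRank]
  exact h1

open Classical in
theorem IsSupersolvable.hasDivisionalComplement {K V : Type*} [Field K]
    [AddCommGroup V] [Module K V] [M.Finite] {v : α → V} (hv : M.IsRep K v) {T : M.FlatLattice}
    (hT : (M.restrict T.1).IsSupersolvable) {X : M.FlatLattice} (hX : X ≤ T)
    (hfull : IsFullFlat K v X) : HasDivisionalComplement M.flatRank T X := by
  obtain ⟨-, n, Y, hY, hmod⟩ := hT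
  -- The flag is extended to all of `ℕ`, constant from `n` on.
  let c : ℕ → M.FlatLattice := fun i ↦
    ⟨Y ⟨min i n, by omega⟩, isFlat_of_restrict T.2 (hY.isFlat _)⟩
  have hcn : c n = T := by
    refine Subtype.ext ?_
    have h1 : (⟨min n n, by omega⟩ : Fin (n + 1)) = Fin.last n := Fin.ext (min_self n)
    change Y ⟨min n n, _⟩ = T.1
    rw [h1, hY.last, restrict_ground_eq]
  have hc : Monotone c := fun i j hij ↦ hY.mono (by
    rw [Fin.mk_le_mk]; omega)
  rw [← hcn] at hX ⊢
  refine HasDivisionalComplement.of_supersolvable (isSemimodularRank_flatRank M)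
    (Full := IsFullFlat K v) (fun h hw ↦ h.isModularBelow hv hw) (fun h hle ↦ h.anti hv hle)
    (fun h ht hrt hxw hew hre hex het ↦ h.proj hv ht hrt hxw hew hre hex het)
    (fun _ _ h z hz ↦ inf_sup_inf_of_atoms h hz) c hc (fun i hi ↦ ?_) (fun i _ ↦ ?_) hX hfull
  · have h1 := hY.rank ⟨min i n, by omega⟩
    rw [M.restrict_eRk_eq (R := T.1) (hY.isFlat _).subset_ground] at h1
    rw [← ENat.natCast_inj, coe_flatRank, h1]
    simp [hi]
  · rw [hcn]
    exact (hmod _).isModularBelow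

open Classical in
-- The strengthened induction. `M` and `v` stay fixed while `T` and `X` vary: one factor is used
-- with the given flat, the other with the intersection of the factors.
theorem _root_.MemJoinClass.hasDivisionalComplement {K V : Type*} [Field K] [Finite K]
    [AddCommGroup V] [Module K V] [M.Finite] {v : α → V} (hv : M.IsRep K v) {N : Matroid α}
    (hN : MemJoinClass K N) {T X : M.FlatLattice} (hNT : N = M.restrict T.1) (hX : X ≤ T)
    (hfull : IsFullFlat K v X) : HasDivisionalComplement M.flatRank T X := by
  have hρ := isSemimodularRank_flatRank M
  induction hN generalizing T X with
  | supersolvable N _ _ hss =>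
    subst hNT
    exact hss.hasDivisionalComplement hv hX hfull
  | modularJoin N _ _ E₁ E₂ hjoin k hPG _ _ ih₁ ih₂ =>
    subst hNT
    have hT₁ := hjoin.modular_left.isModularBelow
    have hT₂ := hjoin.modular_right.isModularBelow
    have hE₁ : E₁ ⊆ T.1 := hT₁.le
    have hE₂ : E₂ ⊆ T.1 := hT₂.le
    have hunion : E₁ ∪ E₂ = T.1 := hjoin.union_eq
    have hres₁ : (M.restrict T.1).restrict E₁ = M.restrict E₁ := M.restrict_restrict_eq hE₁
    have hres₂ : (M.restrict T.1).restrict E₂ = M.restrict E₂ := M.restrict_restrict_eq hE₂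
    rw [M.restrict_restrict_eq (Set.inter_subset_left.trans hE₁)] at hPG
    set T₁ : M.FlatLattice := ⟨E₁, _⟩
    set T₂ : M.FlatLattice := ⟨E₂, _⟩
    have hfull' : IsFullFlat K v (T₁ ⊓ T₂) := by
      refine isFullFlat_of_isIsomorphicTo_projectiveGeometry hv (fun e he f hf ↦ ?_) hPG
      exact (restrict_indep_iff.1 (hjoin.isSimple e (hE₁ he.1) f (hE₁ hf.1))).1
    have hcover : ∀ z ≤ T, z ≤ (z ⊓ T₁) ⊔ (z ⊓ T₂) := fun z hz ↦
      le_inf_sup_inf (hunion.symm ▸ hz)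
    rcases hfull.le_or_le hv (G := T₁) (H := T₂) (hunion.symm ▸ hX) with h | h
    · refine .join hρ hT₂ hT₁ (fun z hz ↦ ?_) ?_ h (ih₁ hres₁ h hfull)
      · rw [sup_comm]; exact hcover z hz
      · rw [inf_comm]; exact ih₂ hres₂ inf_le_right hfull'
    · exact .join hρ hT₁ hT₂ hcover (ih₁ hres₁ inf_le_left hfull') h (ih₂ hres₂ h hfull)

theorem _root_.MemJoinClass.hasDivisionalFlag {K : Type*} [Field K] [Finite K] [M.Finite]
    (hM : MemJoinClass K M) : M.HasDivisionalFlag := by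
  classical
  have hrep : M.IsRepresentableOver K := by cases hM <;> assumption
  have hsimple : M.IsSimple := by
    cases hM with
    | supersolvable _ _ _ hss => exact hss.1
    | modularJoin _ _ _ _ _ hjoin => exact hjoin.isSimple
  obtain ⟨n, v, hv⟩ := hrep
  have hloops : M.closure ∅ = ∅ := by
    refine Set.eq_empty_iff_forall_notMem.2 fun e he ↦ ?_
    have h1 : M.IsLoop e := he
    have h2 := hsimple e h1.mem_ground e h1.mem_ground
    rw [Set.pair_eq_singleton] at h2
    exact h1.not_indep_of_mem (Set.mem_singleton e) h2
  -- The bottom flat is vacuously full, and a complement of it has full rank.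
  obtain ⟨z, hz, hchain, -, hrank⟩ := hM.hasDivisionalComplement (T := M.topFlat) (v := v) hv
    (M.restrict_ground_eq_self).symm bot_le (isFullFlat_bot hv)
  have hρ := isSemimodularRank_flatRank M
  have hztop : z = M.topFlat := by
    by_contra hne
    have := hρ.strictMono (lt_of_le_of_ne hz hne)
    rw [hρ.bot] at hrank
    omega
  rw [hztop] at hchain
  refine hasDivisionalFlag_of_chain hloops ?_
  convert hchain

end Matroid

theorem mainTheorem5 {K V : Type*} [Field K] [Finite K] [AddCommGroup V] [Module K V]
    [FiniteDimensional K V] (A : HyperplaneArrangement K V)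
    (hA : MemJoinClass K A.matroid) : A.IsDivisionallyFree :=
  hA.hasDivisionalFlag
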